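/- Let $\mathbb T$ be the unit circle with normalized Lebesgue measure $m$, let $L^2=L^2(\mathbb T,m)$ and $L^\infty=L^\infty(\mathbb T,m)$, let $H^2\subset L^2$ be the Hardy space, i.e. the closed subspace of those $f\in L^2$ whose Fourier coefficients of negative index all vanish, and let $P\colon L^2\to H^2$ be the orthogonal projection. For $\varphi\in L^\infty$ the Toeplitz operator $T_\varphi\colon H^2\to H^2$ is $T_\varphi f=P(\varphi f)$. An inner function is a function $\alpha\in L^\infty$ whose Fourier coefficients of negative index all vanish and which satisfies $|\alpha|=1$ a.e. on $\mathbb T$. For an inner function $\alpha$ let $K^2_\alpha=H^2\ominus\alpha H^2$, let $P_\alpha\colon L^2\to K^2_\alpha$ be the orthogonal projection, and let $C_\alpha\colon K^2_\alpha\to K^2_\alpha$ be the conjugation $C_\alpha f(z)=\alpha(z)\overline{zf(z)}$, $|z|=1$. For a bounded linear operator $A$ on $H^2$ put $A_\alpha=P_\alpha A|_{K^2_\alpha}\colon K^2_\alpha\to K^2_\alpha$. Let $A$ be a bounded linear operator on $H^2$. Then the following conditions are equivalent: (1) $A=T_\varphi$ for some $\varphi\in L^\infty$; (2) $C_\alpha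 A_\alpha C_\alpha=A_\alpha^*$ for every nonconstant inner function $\alpha$; (3) $C_\alpha A_\alpha C_\alpha=A_\alpha^*$ for every $\alpha=z^n$ with $n\ge 1$ an integer. -/

import Mathlib

open MeasureTheory
open scoped ENNReal InnerProductSpace

noncomputable section

namespace ModelSpace

/-- Normalized Lebesgue measure on the unit circle. The circle is parametrized by
`t ↦ z = exp (2 π i t)` with `t ∈ ℝ / ℤ`, so that `z ^ n` is `fourier n`. -/
abbrev circleMeasure : Measure UnitAddCircle := AddCircle.haarAddCircle

/-- `L²(𝕋, m)`. -/
abbrev L2 : Type := Lp ℂ 2 circleMeasure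

/-- `L^∞(𝕋, m)`. -/
abbrev Linf : Type := Lp ℂ ∞ circleMeasure

/-- The function `z ^ n` as an element of `L^∞`. -/
def zPow (n : ℤ) : Linf := fourierLp ∞ n

/-- Multiplication by `φ ∈ L^∞`, as a bounded operator on `L²`. -/
def mulOp (φ : Linf) : L2 →L[ℂ] L2 :=
  (ContinuousLinearMap.mul ℂ ℂ).holderL circleMeasure ∞ 2 2 φ

/-- The Hardy space `H²`, as the subspace of `L²` of the functions all of whose Fourier
coefficients of negative index vanish. -/
def hardySpace : Submodule ℂ L2 where
  carrier := {f | ∀ n : ℤ, n < 0 → fourierCoeff f n = 0}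
  zero_mem' := by
    intro n _
    rw [← fourierBasis_repr]
    simp
  add_mem' := by
    intro f g hf hg n hn
    have h1 := hf n hn
    have h2 := hg n hn
    rw [← fourierBasis_repr] at h1 h2 ⊢
    simp [h1, h2]
  smul_mem' := by
    intro c f hf n hn
    have h1 := hf n hn
    rw [← fourierBasis_repr] at h1 ⊢
    simp [h1]

theorem mem_hardySpace_iff {f : L2} :
    f ∈ hardySpace ↔ ∀ n : ℤ, n < 0 → ⟪(fourierLp 2 n : L2), f⟫_ℂ = 0 := by
  have h : ∀ n : ℤ, ⟪(fourierLp 2 n : L2), f⟫_ℂ = fourierCoeff f n := by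
    intro n
    rw [← fourierBasis_repr, fourierBasis.repr_apply_apply, coe_fourierBasis]
  simp only [h]
  rfl

theorem isClosed_hardySpace : IsClosed (hardySpace : Set L2) := by
  have h : (hardySpace : Set L2) =
      ⋂ n : ℤ, ⋂ _ : n < 0, {f : L2 | ⟪(fourierLp 2 n : L2), f⟫_ℂ = 0} := by
    ext f
    simp [mem_hardySpace_iff]
  rw [h]
  refine isClosed_iInter fun n => isClosed_iInter fun _ => ?_
  exact isClosed_eq (by fun_prop) continuous_const

instance : CompleteSpace hardySpace := isClosed_hardySpace.completeSpace_coe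

/-- The Toeplitz operator `T_φ f = P (φ f)` on `H²`, where `P : L² → H²` is the orthogonal
projection. -/
def toeplitz (φ : Linf) : hardySpace →L[ℂ] hardySpace :=
  hardySpace.orthogonalProjectionOnto ∘L mulOp φ ∘L hardySpace.subtypeL

/-- `α` is (the boundary function of) an inner function: a bounded function all of whose Fourier
coefficients of negative index vanish, and which is unimodular almost everywhere on the circle. -/
structure IsInner (α : Linf) : Prop where
  fourierCoeff_eq_zero : ∀ n : ℤ, n < 0 → fourierCoeff α n = 0
  norm_eq_one : ∀ᵐ t ∂circleMeasure, ‖α t‖ = 1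

/-- `α` is (almost everywhere equal to) a constant. -/
def IsConstant (α : Linf) : Prop := ∃ c : ℂ, ∀ᵐ t ∂circleMeasure, α t = c

/-- The model space `K²_α = H² ⊖ α H²`. -/
def modelSpace (α : Linf) : Submodule ℂ L2 :=
  hardySpace ⊓ (hardySpace.map (mulOp α : L2 →ₗ[ℂ] L2))ᗮ

theorem modelSpace_le (α : Linf) : modelSpace α ≤ hardySpace := inf_le_left

instance (α : Linf) : CompleteSpace (modelSpace α) :=
  (isClosed_hardySpace.inter (Submodule.isClosed_orthogonal _)).completeSpace_coe

/-- The inclusion `K²_α → H²`. -/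
def modelInclusion (α : Linf) : modelSpace α →L[ℂ] hardySpace :=
  (modelSpace α).subtypeL.codRestrict hardySpace fun f => modelSpace_le α f.2

/-- The compression `A_α = P_α A|K²_α` of an operator `A` on `H²` to the model space, where
`P_α : L² → K²_α` is the orthogonal projection. -/
def compression (A : hardySpace →L[ℂ] hardySpace) (α : Linf) :
    modelSpace α →L[ℂ] modelSpace α :=
  (modelSpace α).orthogonalProjectionOnto ∘L hardySpace.subtypeL ∘L A ∘L modelInclusion α

/-- The map `C_α f (z) = α(z) * conj (z * f(z))` on `L²`. -/
def conjL2 (α : Linf) (f : L2) : L2 := mulOp α (star (mulOp (zPow 1) f))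

theorem coeFn_mulOp (φ : Linf) (f : L2) :
    ∀ᵐ t ∂circleMeasure, mulOp φ f t = φ t * f t :=
  (ContinuousLinearMap.mul ℂ ℂ).coeFn_holder φ f

theorem coeFn_zPow (n : ℤ) : ∀ᵐ t ∂circleMeasure, zPow n t = fourier n t :=
  coeFn_fourierLp ∞ n

theorem coeFn_conjL2 (α : Linf) (f : L2) :
    ∀ᵐ t ∂circleMeasure, conjL2 α f t = α t * (starRingEnd ℂ) (fourier 1 t * f t) := by
  filter_upwards [coeFn_mulOp α (star (mulOp (zPow 1) f)), Lp.coeFn_star (mulOp (zPow 1) f),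
    coeFn_mulOp (zPow 1) f, coeFn_zPow 1] with t h1 h2 h3 h4
  rw [conjL2, h1, h2, Pi.star_apply, h3, h4]
  rfl

theorem fourierLp_mem_hardySpace {n : ℤ} (hn : 0 ≤ n) : (fourierLp 2 n : L2) ∈ hardySpace := by
  rw [mem_hardySpace_iff]
  intro m hm
  exact orthonormal_fourier.2 (by omega)

/-- `C_α` maps the model space of an inner function `α` into itself. -/
theorem conjL2_mem_modelSpace {α : Linf} (hα : IsInner α) {f : L2} (hf : f ∈ modelSpace α) :
    conjL2 α f ∈ modelSpace α := by
  obtain ⟨hf1, hf2⟩ := Submodule.mem_inf.1 hf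
  refine Submodule.mem_inf.2 ⟨?_, ?_⟩
  · rw [mem_hardySpace_iff]
    intro n hn
    have h0 : ⟪f, mulOp α (fourierLp 2 (-n - 1))⟫_ℂ = 0 :=
      (Submodule.mem_orthogonal' _ _).1 hf2 _
        (Submodule.mem_map_of_mem (fourierLp_mem_hardySpace (by omega)))
    rw [← h0, L2.inner_def, L2.inner_def]
    refine integral_congr_ae ?_
    filter_upwards [coeFn_conjL2 α f, coeFn_mulOp α (fourierLp 2 (-n - 1)),
      coeFn_fourierLp 2 n, coeFn_fourierLp 2 (-n - 1)] with t h1 h2 h3 h4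
    simp only [RCLike.inner_apply]
    rw [h1, h2, h3, h4, sub_eq_add_neg, fourier_add, ← fourier_neg, map_mul, ← fourier_neg]
    ring
  · rw [Submodule.mem_orthogonal]
    rintro _ ⟨h, hh, rfl⟩
    have key : ⟪mulOp α h, conjL2 α f⟫_ℂ = ⟪f, star (mulOp (zPow 1) h)⟫_ℂ := by
      rw [L2.inner_def, L2.inner_def]
      refine integral_congr_ae ?_
      filter_upwards [coeFn_conjL2 α f, coeFn_mulOp α h, hα.norm_eq_one,
        Lp.coeFn_star (mulOp (zPow 1) h), coeFn_mulOp (zPow 1) h, coeFn_zPow 1]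
        with t h1 h2 h3 h4 h5 h6
      have hu : α t * (starRingEnd ℂ) (α t) = 1 := by
        rw [RCLike.mul_conj, h3]
        simp
      simp only [RCLike.inner_apply]
      rw [h1, h2, h4, Pi.star_apply, h5, h6]
      simp only [map_mul, RCLike.star_def]
      linear_combination ((starRingEnd ℂ) (fourier 1 t) * (starRingEnd ℂ) (f t) *
        (starRingEnd ℂ) (h t)) * hu
    change ⟪mulOp α h, conjL2 α f⟫_ℂ = 0
    rw [key, ← fourierBasis.tsum_inner_mul_inner]
    refine (tsum_congr fun n => ?_).trans tsum_zero
    rw [coe_fourierBasis]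
    rcases lt_or_ge n 0 with hn | hn
    · rw [← inner_conj_symm, mem_hardySpace_iff.1 hf1 n hn]
      simp
    · have h0 := mem_hardySpace_iff.1 hh (-n - 1) (by omega)
      have h1 : ⟪(fourierLp 2 n : L2), star (mulOp (zPow 1) h)⟫_ℂ =
          ⟪h, (fourierLp 2 (-n - 1) : L2)⟫_ℂ := by
        rw [L2.inner_def, L2.inner_def]
        refine integral_congr_ae ?_
        filter_upwards [Lp.coeFn_star (mulOp (zPow 1) h), coeFn_mulOp (zPow 1) h, coeFn_zPow 1,
          coeFn_fourierLp 2 n, coeFn_fourierLp 2 (-n - 1)] with t h1 h2 h3 h4 h5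
        simp only [RCLike.inner_apply]
        rw [h1, Pi.star_apply, h2, h3, h4, h5, sub_eq_add_neg, fourier_add, fourier_neg,
          fourier_neg]
        simp only [map_mul, RCLike.star_def]
        ring
      rw [h1, ← inner_conj_symm h, h0]
      simp

/-- The conjugation `C_α` on the model space `K²_α` of an inner function `α`. -/
def modelConj {α : Linf} (hα : IsInner α) (f : modelSpace α) : modelSpace α :=
  ⟨conjL2 α f, conjL2_mem_modelSpace hα f.2⟩

/-- A bounded operator `A` is `C`-symmetric if `C A C = A*`. -/
def IsCSymmetric {H : Type*} [NormedAddCommGroup H] [InnerProductSpace ℂ H] [CompleteSpace H]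
    (C : H → H) (A : H →L[ℂ] H) : Prop :=
  ∀ f : H, C (A (C f)) = ContinuousLinearMap.adjoint A f

/-- `z ^ n` is inner for every natural number `n`. -/
theorem isInner_zPow (n : ℕ) : IsInner (zPow n) where
  fourierCoeff_eq_zero := by
    intro m hm
    have h := mem_hardySpace_iff.1 (fourierLp_mem_hardySpace (Int.natCast_nonneg n)) m hm
    rw [← h, L2.inner_def]
    refine integral_congr_ae ?_
    filter_upwards [coeFn_zPow n, coeFn_fourierLp 2 m, coeFn_fourierLp 2 (n : ℤ)]
      with t h1 h2 h3
    rw [RCLike.inner_apply, h1, h2, h3, ← fourier_neg, smul_eq_mul, mul_comm]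
  norm_eq_one := by
    filter_upwards [coeFn_zPow n] with t h1
    rw [h1, fourier_apply]
    exact Circle.norm_coe _

end ModelSpace

end

/-!
For polynomials `C_{zⁿ}` is the flip `zᵏ ↦ zⁿ⁻¹⁻ᵏ`. Taking `n = i + j + 2`, symmetry of the
compression to `K²_{zⁿ}` turns the `(i, j)` entry of the matrix of `A` into the `(i + 1, j + 1)`
entry, so (3) says that this matrix is constant along its diagonals. By the Brown–Halmos argument,
the operators `f ↦ z⁻ᵏ A P (zᵏ f)` on `L²` then have a weak limit point which commutes with the
bilateral shift and whose matrix extends that of `A`. An operator commuting with the bilateral shift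
is multiplication by an essentially bounded function, the symbol of `A`. Conversely, conjugating
multiplication by `φ` with `C_α` yields multiplication by `conj φ` as soon as `|α| = 1`, whence (2).
-/

noncomputable section

open Filter Topology

section OperatorTheory

variable {𝕜 E F : Type*} [RCLike 𝕜]
  [NormedAddCommGroup E] [InnerProductSpace 𝕜 E] [NormedAddCommGroup F] [InnerProductSpace 𝕜 F]

theorem eq_of_inner_hilbertBasis_left {ι : Type*} (b : HilbertBasis ι 𝕜 E) {x y : E}
    (h : ∀ i, ⟪b i, x⟫_𝕜 = ⟪b i, y⟫_𝕜) : x = y :=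
  b.repr.injective <| lp.ext <| funext fun i => by
    rw [b.repr_apply_apply, b.repr_apply_apply, h]

theorem clm_eq_of_inner_hilbertBasis {ι κ : Type*} (b : HilbertBasis ι 𝕜 E)
    (c : HilbertBasis κ 𝕜 F) {S T : E →L[𝕜] F}
    (h : ∀ i j, ⟪c i, S (b j)⟫_𝕜 = ⟪c i, T (b j)⟫_𝕜) : S = T := by
  refine ContinuousLinearMap.ext_on
    (Submodule.dense_iff_topologicalClosure_eq_top.2 b.dense_span) ?_
  rintro _ ⟨j, rfl⟩
  exact eq_of_inner_hilbertBasis_left c fun i => h i j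

/-- Closed balls of operators are compact in the weak operator topology. -/
theorem exists_tendsto_inner_of_norm_le [CompleteSpace F] {ι : Type*} (u : Ultrafilter ι)
    {B : ι → E →L[𝕜] F} {C : ℝ} (hB : ∀ k, ‖B k‖ ≤ C) :
    ∃ T : E →L[𝕜] F, ∀ x y, Tendsto (fun k => ⟪y, B k x⟫_𝕜) u (𝓝 ⟪y, T x⟫_𝕜) := by
  have hbound : ∀ x y k, ‖⟪B k x, y⟫_𝕜‖ ≤ C * ‖x‖ * ‖y‖ := fun x y k =>
    (norm_inner_le_norm _ _).trans <| by gcongr; exact (B k).le_of_opNorm_le (hB k) x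
  have hlim : ∀ x y, ∃ a, ‖a‖ ≤ C * ‖x‖ * ‖y‖ ∧ Tendsto (fun k => ⟪B k x, y⟫_𝕜) u (𝓝 a) := by
    intro x y
    obtain ⟨a, ha, hua⟩ := (isCompact_closedBall (0 : 𝕜) (C * ‖x‖ * ‖y‖)).ultrafilter_le_nhds'
      (u.map fun k => ⟪B k x, y⟫_𝕜)
      (Filter.mem_map.2 <| Eventually.of_forall fun k => mem_closedBall_zero_iff.2 (hbound x y k))
    exact ⟨a, mem_closedBall_zero_iff.1 ha, hua⟩
  choose form hform htends using hlim
  let formₗ : E →ₗ⋆[𝕜] F →ₗ[𝕜] 𝕜 := LinearMap.mk₂'ₛₗ (starRingEnd 𝕜) (RingHom.id 𝕜) form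
    (fun x x' y => tendsto_nhds_unique (htends _ _) <| by
      simpa only [map_add, inner_add_left] using (htends x y).add (htends x' y))
    (fun c x y => tendsto_nhds_unique (htends _ _) <| by
      simpa only [map_smul, inner_smul_left, smul_eq_mul]
        using (htends x y).const_mul (starRingEnd 𝕜 c))
    (fun x y y' => tendsto_nhds_unique (htends _ _) <| by
      simpa only [inner_add_right] using (htends x y).add (htends x y'))
    (fun c x y => tendsto_nhds_unique (htends _ _) <| by
      simpa only [inner_smul_right, smul_eq_mul, RingHom.id_apply] using (htends x y).const_mul c)
  let formL : E →L⋆[𝕜] StrongDual 𝕜 F := formₗ.mkContinuous₂ C hform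
  let T : E →L[𝕜] F :=
    (InnerProductSpace.toDual 𝕜 F).symm.toContinuousLinearEquiv.toContinuousLinearMap.comp formL
  refine ⟨T, fun x y => ?_⟩
  have hT : ⟪T x, y⟫_𝕜 = form x y := InnerProductSpace.toDual_symm_apply
  have htends_left : Tendsto (fun k => ⟪B k x, y⟫_𝕜) u (𝓝 ⟪T x, y⟫_𝕜) := hT ▸ htends x y
  simpa only [RCLike.star_def, inner_conj_symm] using htends_left.star

end OperatorTheory

theorem eLpNorm_top_le_of_eLpNorm_indicator_le {X G : Type*} [MeasurableSpace X] {μ : Measure X}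
    [SigmaFinite μ] [NormedAddCommGroup G] {f : X → G} (hf : AEStronglyMeasurable f μ)
    {p : ℝ≥0∞} (hp : p ≠ 0) (hp' : p ≠ ∞) {C : ℝ≥0∞}
    (h : ∀ s, MeasurableSet s → μ s < ∞ →
      eLpNorm (s.indicator f) p μ ≤ C * μ s ^ (1 / p.toReal)) :
    eLpNorm f ∞ μ ≤ C := by
  have hp0 : 0 < p.toReal := ENNReal.toReal_pos hp hp'
  have hpow : (fun x => ‖f x‖ₑ ^ p.toReal) ≤ᵐ[μ] fun _ => C ^ p.toReal := by
    refine ae_le_of_forall_setLIntegral_le_of_sigmaFinite₀ (hf.enorm.pow_const _) fun s hs hμs => ?_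
    calc ∫⁻ x in s, ‖f x‖ₑ ^ p.toReal ∂μ = eLpNorm (s.indicator f) p μ ^ p.toReal := by
          rw [eLpNorm_indicator_eq_eLpNorm_restrict hs,
            eLpNorm_eq_lintegral_rpow_enorm_toReal hp hp', ← ENNReal.rpow_mul,
            one_div_mul_cancel hp0.ne', ENNReal.rpow_one]
      _ ≤ (C * μ s ^ (1 / p.toReal)) ^ p.toReal := by gcongr; exact h s hs hμs
      _ = ∫⁻ _ in s, C ^ p.toReal ∂μ := by
          rw [ENNReal.mul_rpow_of_nonneg _ _ hp0.le, ← ENNReal.rpow_mul,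
            one_div_mul_cancel hp0.ne', ENNReal.rpow_one, setLIntegral_const]
  refine eLpNormEssSup_le_of_ae_enorm_bound ?_
  filter_upwards [hpow] with x hx using (ENNReal.rpow_le_rpow_iff hp0).1 hx

namespace ModelSpace

section Multiplication

/-- The function `zⁿ` as an element of `L²`. -/
abbrev monomial (n : ℤ) : L2 := fourierLp 2 n

theorem inner_mulOp_mulOp {α : Linf} (hα : ∀ᵐ t ∂circleMeasure, ‖α t‖ = 1) (f g : L2) :
    ⟪mulOp α f, mulOp α g⟫_ℂ = ⟪f, g⟫_ℂ := by
  rw [L2.inner_def, L2.inner_def]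
  refine integral_congr_ae ?_
  filter_upwards [coeFn_mulOp α f, coeFn_mulOp α g, hα] with t hf hg hαt
  have hunit : α t * (starRingEnd ℂ) (α t) = 1 := by simp [RCLike.mul_conj, hαt]
  simp only [RCLike.inner_apply, hf, hg, map_mul]
  linear_combination (g t * (starRingEnd ℂ) (f t)) * hunit

theorem ae_norm_zPow (n : ℤ) : ∀ᵐ t ∂circleMeasure, ‖zPow n t‖ = 1 := by
  filter_upwards [coeFn_zPow n] with t ht
  rw [ht, fourier_apply, Circle.norm_coe]

theorem norm_mulOp_zPow (n : ℤ) (f : L2) : ‖mulOp (zPow n) f‖ = ‖f‖ := by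
  rw [@norm_eq_sqrt_re_inner ℂ, inner_mulOp_mulOp (ae_norm_zPow n), ← norm_eq_sqrt_re_inner]

theorem mulOp_zPow_zero : mulOp (zPow 0) = 1 := by
  ext1 f
  refine Lp.ext ?_
  filter_upwards [coeFn_mulOp (zPow 0) f, coeFn_zPow 0] with t h h0
  rw [h, h0, fourier_zero, one_mul, one_apply_eq_self]

theorem mulOp_zPow_add (m n : ℤ) : mulOp (zPow (m + n)) = mulOp (zPow m) * mulOp (zPow n) := by
  ext1 f
  refine Lp.ext ?_
  filter_upwards [coeFn_mulOp (zPow (m + n)) f, coeFn_mulOp (zPow m) (mulOp (zPow n) f),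
    coeFn_mulOp (zPow n) f, coeFn_zPow m, coeFn_zPow n, coeFn_zPow (m + n)]
    with t h hm hn hzm hzn hz
  rw [mul_apply_eq_comp, h, hm, hn, hzm, hzn, hz, fourier_add, mul_assoc]

theorem mulOp_zPow_monomial (m n : ℤ) : mulOp (zPow m) (monomial n) = monomial (m + n) := by
  refine Lp.ext ?_
  filter_upwards [coeFn_mulOp (zPow m) (monomial n), coeFn_zPow m, coeFn_fourierLp 2 n,
    coeFn_fourierLp 2 (m + n)] with t h hz hn hmn
  rw [h, hz, hn, hmn, fourier_add]

theorem coeFn_mulOp_zPow (f : L2) (n : ℤ) :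
    mulOp (zPow n) f =ᵐ[circleMeasure] fun t => f t * monomial n t := by
  filter_upwards [coeFn_mulOp (zPow n) f, coeFn_zPow n, coeFn_fourierLp 2 n] with t h hz hn
  rw [h, hz, hn, mul_comm]

end Multiplication

section BilateralShift

theorem commute_mulOp_zPow {T : L2 →L[ℂ] L2} (hT : Commute T (mulOp (zPow 1))) (n : ℤ) :
    Commute T (mulOp (zPow n)) := by
  let shift : (L2 →L[ℂ] L2)ˣ :=
    { val := mulOp (zPow 1)
      inv := mulOp (zPow (-1))
      val_inv := by rw [← mulOp_zPow_add, add_neg_cancel, mulOp_zPow_zero]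
      inv_val := by rw [← mulOp_zPow_add, neg_add_cancel, mulOp_zPow_zero] }
  have hT' : Commute T (mulOp (zPow (-1))) := Commute.units_inv_right (u := shift) hT
  induction n with
  | zero => exact mulOp_zPow_zero ▸ Commute.one_right T
  | succ n ih => exact mulOp_zPow_add _ _ ▸ ih.mul_right hT
  | pred n ih => exact sub_eq_add_neg (-(n : ℤ)) 1 ▸ mulOp_zPow_add _ _ ▸ ih.mul_right hT'

theorem commute_mulOp_zPow_one_of_inner_monomial {T : L2 →L[ℂ] L2}
    (hT : ∀ i j : ℤ,
      ⟪monomial (1 + i), T (monomial (1 + j))⟫_ℂ = ⟪monomial i, T (monomial j)⟫_ℂ) :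
    Commute T (mulOp (zPow 1)) := by
  refine clm_eq_of_inner_hilbertBasis fourierBasis fourierBasis fun i j => ?_
  obtain ⟨i, rfl⟩ : ∃ i', i = 1 + i' := ⟨i - 1, by ring⟩
  rw [coe_fourierBasis]
  calc ⟪monomial (1 + i), T (mulOp (zPow 1) (monomial j))⟫_ℂ
      = ⟪monomial i, T (monomial j)⟫_ℂ := by rw [mulOp_zPow_monomial, hT]
    _ = ⟪monomial (1 + i), mulOp (zPow 1) (T (monomial j))⟫_ℂ := by
      rw [← mulOp_zPow_monomial, inner_mulOp_mulOp (ae_norm_zPow 1)]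

theorem exists_eq_mulOp_of_forall_ae_eq {T : L2 →L[ℂ] L2} {φ : L2}
    (hT : ∀ f : L2, T f =ᵐ[circleMeasure] fun t => φ t * f t) : ∃ ψ : Linf, T = mulOp ψ := by
  have hbound : eLpNorm φ ∞ circleMeasure ≤ ‖T‖ₑ := by
    refine eLpNorm_top_le_of_eLpNorm_indicator_le (Lp.aestronglyMeasurable φ) two_ne_zero
      ENNReal.ofNat_ne_top fun s hs hμs => ?_
    let χ : L2 := indicatorConstLp 2 hs hμs.ne 1
    have hTχ : s.indicator φ =ᵐ[circleMeasure] T χ := by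
      have hχ_coe : χ =ᵐ[circleMeasure] s.indicator fun _ => 1 := indicatorConstLp_coeFn
      filter_upwards [hT χ, hχ_coe] with t ht hχ
      by_cases hts : t ∈ s <;> simp [ht, hχ, hts]
    have hχ : ‖χ‖ₑ = circleMeasure s ^ (1 / (2 : ℝ≥0∞).toReal) := by
      rw [Lp.enorm_def, eLpNorm_congr_ae indicatorConstLp_coeFn,
        eLpNorm_indicator_const hs two_ne_zero ENNReal.ofNat_ne_top, enorm_one, one_mul]
    rw [eLpNorm_congr_ae hTχ, ← Lp.enorm_def, ← hχ]
    exact T.le_opENorm χ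
  have hφ : MemLp φ ∞ circleMeasure :=
    ⟨Lp.aestronglyMeasurable φ, hbound.trans_lt enorm_lt_top⟩
  refine ⟨hφ.toLp φ, ContinuousLinearMap.ext fun f => Lp.ext ?_⟩
  filter_upwards [hT f, coeFn_mulOp (hφ.toLp φ) f, hφ.coeFn_toLp] with t hTf hmul hφt
  rw [hTf, hmul, hφt]

theorem exists_eq_mulOp_of_commute {T : L2 →L[ℂ] L2} (hT : Commute T (mulOp (zPow 1))) :
    ∃ ψ : Linf, T = mulOp ψ := by
  set φ := T (monomial 0)
  let pair : L2 →L[ℂ] L2 →L[ℂ] Lp ℂ 1 circleMeasure :=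
    (ContinuousLinearMap.mul ℂ ℂ).holderL circleMeasure 2 2 1
  have hpair : ∀ f g : L2, pair f g =ᵐ[circleMeasure] fun t => f t * g t :=
    (ContinuousLinearMap.mul ℂ ℂ).coeFn_holder
  have hT_monomial : ∀ n, T (monomial n) = mulOp (zPow n) φ := fun n => by
    have hcomm := DFunLike.congr_fun (commute_mulOp_zPow hT n).eq (monomial 0)
    simpa only [mul_apply_eq_comp, mulOp_zPow_monomial, add_zero] using hcomm
  -- The identity `1 · T f = φ · f` is continuous in `f` when read in `L¹`.
  have hL1 : pair (monomial 0) ∘L T = pair φ := by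
    refine ContinuousLinearMap.ext_on (Submodule.dense_iff_topologicalClosure_eq_top.2
      (span_fourierLp_closure_eq_top (p := 2) ENNReal.ofNat_ne_top)) ?_
    rintro _ ⟨n, rfl⟩
    refine Lp.ext ?_
    filter_upwards [hpair (monomial 0) (T (monomial n)), hpair φ (monomial n),
      coeFn_mulOp_zPow φ n, coeFn_fourierLp 2 0] with t h1 h2 h3 h4
    rw [ContinuousLinearMap.comp_apply, h1, h2, ← h3, h4, fourier_zero, one_mul, hT_monomial]
  refine exists_eq_mulOp_of_forall_ae_eq (φ := φ) fun f => ?_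
  filter_upwards [hpair (monomial 0) (T f), hpair φ f, coeFn_fourierLp 2 0] with t h1 h2 h3
  rw [← h2, ← hL1, ContinuousLinearMap.comp_apply, h1, h3, fourier_zero, one_mul]

end BilateralShift

section BrownHalmos

theorem orthonormal_hardy_monomial :
    Orthonormal ℂ fun n : ℕ =>
      (⟨monomial n, fourierLp_mem_hardySpace n.cast_nonneg⟩ : hardySpace) :=
  (orthonormal_fourier.comp _ Nat.cast_injective).codRestrict hardySpace _

/-- The monomials `zⁿ`, `n ≥ 0`, as a Hilbert basis of `H²`. -/
def hardyBasis : HilbertBasis ℕ ℂ hardySpace :=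
  HilbertBasis.mkOfOrthogonalEqBot orthonormal_hardy_monomial <| by
    refine (Submodule.eq_bot_iff _).2 fun f hf => Subtype.ext ?_
    refine eq_of_inner_hilbertBasis_left fourierBasis fun m => ?_
    rw [coe_fourierBasis, ZeroMemClass.coe_zero, inner_zero_right]
    rcases lt_or_ge m 0 with hm | hm
    · exact mem_hardySpace_iff.1 f.2 m hm
    · lift m to ℕ using hm
      exact hf _ (Submodule.subset_span ⟨m, rfl⟩)

theorem coe_hardyBasis (n : ℕ) : (hardyBasis n : L2) = monomial n := by
  rw [hardyBasis, HilbertBasis.coe_mkOfOrthogonalEqBot]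

theorem inner_toeplitz (φ : Linf) (f g : hardySpace) :
    ⟪f, toeplitz φ g⟫_ℂ = ⟪(f : L2), mulOp φ g⟫_ℂ :=
  hardySpace.inner_orthogonalProjectionOnto_eq_of_mem_left f (mulOp φ g)

/-- The contraction `f ↦ P (zᵏ f)` of `L²` into `H²`. -/
def shiftProj (k : ℤ) : L2 →L[ℂ] hardySpace :=
  hardySpace.orthogonalProjectionOnto ∘L mulOp (zPow k)

theorem norm_shiftProj_le (k : ℤ) : ‖shiftProj k‖ ≤ 1 :=
  ContinuousLinearMap.opNorm_le_bound _ zero_le_one fun f => by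
    rw [one_mul, ← norm_mulOp_zPow k f]
    exact hardySpace.norm_orthogonalProjectionOnto_apply_le _

theorem shiftProj_monomial {k j : ℤ} {n : ℕ} (h : k + j = n) :
    shiftProj k (monomial j) = hardyBasis n := by
  rw [shiftProj, ContinuousLinearMap.comp_apply, mulOp_zPow_monomial, h, ← coe_hardyBasis,
    Submodule.orthogonalProjectionOnto_mem_subspace_eq_self]

/-- The operator `f ↦ z⁻ᵏ A P (zᵏ f)` on `L²`, whose matrix is that of `A` moved `k` steps up the
diagonal. Multiplication by `z⁻ᵏ` on `H²` is expressed as the adjoint of `f ↦ P (zᵏ f)`. -/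
def shiftedDilation (A : hardySpace →L[ℂ] hardySpace) (k : ℤ) : L2 →L[ℂ] L2 :=
  ContinuousLinearMap.adjoint (shiftProj k) ∘L A ∘L shiftProj k

theorem inner_shiftedDilation (A : hardySpace →L[ℂ] hardySpace) (k : ℤ) (f g : L2) :
    ⟪f, shiftedDilation A k g⟫_ℂ = ⟪shiftProj k f, A (shiftProj k g)⟫_ℂ := by
  rw [shiftedDilation, ContinuousLinearMap.comp_apply, ContinuousLinearMap.adjoint_inner_right,
    ContinuousLinearMap.comp_apply]

theorem norm_shiftedDilation_le (A : hardySpace →L[ℂ] hardySpace) (k : ℤ) :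
    ‖shiftedDilation A k‖ ≤ ‖A‖ :=
  calc ‖shiftedDilation A k‖
      ≤ ‖ContinuousLinearMap.adjoint (shiftProj k)‖ * (‖A‖ * ‖shiftProj k‖) :=
        (ContinuousLinearMap.opNorm_comp_le _ _).trans <| by
          gcongr; exact ContinuousLinearMap.opNorm_comp_le _ _
    _ ≤ 1 * (‖A‖ * 1) := by
        rw [LinearIsometryEquiv.norm_map]
        gcongr <;> exact norm_shiftProj_le k
    _ = ‖A‖ := by rw [one_mul, mul_one]

/-- The matrix of `A` in the basis `1, z, z², …` of `H²` is constant along diagonals. -/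
def HasToeplitzMatrix (A : hardySpace →L[ℂ] hardySpace) : Prop :=
  ∀ i j : ℕ, ⟪hardyBasis (i + 1), A (hardyBasis (j + 1))⟫_ℂ = ⟪hardyBasis i, A (hardyBasis j)⟫_ℂ

namespace HasToeplitzMatrix

variable {A : hardySpace →L[ℂ] hardySpace}

theorem inner_hardyBasis_add (hA : HasToeplitzMatrix A) (k i j : ℕ) :
    ⟪hardyBasis (k + i), A (hardyBasis (k + j))⟫_ℂ = ⟪hardyBasis i, A (hardyBasis j)⟫_ℂ := by
  induction k with
  | zero => rw [zero_add, zero_add]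
  | succ k ih => rw [add_right_comm k 1 i, add_right_comm k 1 j, hA, ih]

theorem inner_shiftedDilation_nat (hA : HasToeplitzMatrix A) (k i j : ℕ) :
    ⟪monomial i, shiftedDilation A k (monomial j)⟫_ℂ = ⟪hardyBasis i, A (hardyBasis j)⟫_ℂ := by
  rw [inner_shiftedDilation, shiftProj_monomial (Nat.cast_add k i).symm,
    shiftProj_monomial (Nat.cast_add k j).symm, hA.inner_hardyBasis_add]

theorem inner_shiftedDilation_one_add (hA : HasToeplitzMatrix A) {k i j : ℤ}
    (hi : 0 ≤ k + i) (hj : 0 ≤ k + j) :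
    ⟪monomial (1 + i), shiftedDilation A k (monomial (1 + j))⟫_ℂ =
      ⟪monomial i, shiftedDilation A k (monomial j)⟫_ℂ := by
  obtain ⟨m, hm⟩ := Int.eq_ofNat_of_zero_le hi
  obtain ⟨n, hn⟩ := Int.eq_ofNat_of_zero_le hj
  rw [inner_shiftedDilation, inner_shiftedDilation, shiftProj_monomial hm, shiftProj_monomial hn,
    shiftProj_monomial (n := m + 1) (by omega), shiftProj_monomial (n := n + 1) (by omega), hA]

theorem exists_commute_extension (hA : HasToeplitzMatrix A) :
    ∃ T : L2 →L[ℂ] L2, Commute T (mulOp (zPow 1)) ∧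
      ∀ i j : ℕ, ⟪monomial i, T (monomial j)⟫_ℂ = ⟪hardyBasis i, A (hardyBasis j)⟫_ℂ := by
  obtain ⟨T, hT⟩ := exists_tendsto_inner_of_norm_le (hyperfilter ℕ)
    fun k : ℕ => norm_shiftedDilation_le A k
  refine ⟨T, commute_mulOp_zPow_one_of_inner_monomial fun i j => ?_, fun i j => ?_⟩
  · refine tendsto_nhds_unique_of_eventuallyEq (hT _ _) (hT _ _) <| Nat.hyperfilter_le_atTop ?_
    filter_upwards [eventually_ge_atTop (i.natAbs + j.natAbs)] with k hk
    exact hA.inner_shiftedDilation_one_add (by omega) (by omega)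
  · refine tendsto_nhds_unique (hT _ _) ?_
    simp only [hA.inner_shiftedDilation_nat, tendsto_const_nhds]

theorem exists_eq_toeplitz (hA : HasToeplitzMatrix A) : ∃ φ : Linf, A = toeplitz φ := by
  obtain ⟨T, hcomm, hT⟩ := hA.exists_commute_extension
  obtain ⟨φ, rfl⟩ := exists_eq_mulOp_of_commute hcomm
  refine ⟨φ, clm_eq_of_inner_hilbertBasis hardyBasis hardyBasis fun i j => ?_⟩
  rw [inner_toeplitz, coe_hardyBasis, coe_hardyBasis, hT]

end HasToeplitzMatrix

end BrownHalmos

section CSymmetry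

theorem isCSymmetric_iff_inner {H : Type*} [NormedAddCommGroup H] [InnerProductSpace ℂ H]
    [CompleteSpace H] {C : H → H} (hC : ∀ f g, ⟪C f, g⟫_ℂ = ⟪C g, f⟫_ℂ) {T : H →L[ℂ] H} :
    IsCSymmetric C T ↔ ∀ f g, ⟪C g, T (C f)⟫_ℂ = ⟪f, T g⟫_ℂ := by
  refine forall_congr' fun f => (ext_iff_inner_right ℂ).trans <| forall_congr' fun g => ?_
  rw [hC, ContinuousLinearMap.adjoint_inner_left]

theorem inner_conjL2_comm (α : Linf) (f g : L2) : ⟪conjL2 α f, g⟫_ℂ = ⟪conjL2 α g, f⟫_ℂ := by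
  rw [L2.inner_def, L2.inner_def]
  refine integral_congr_ae ?_
  filter_upwards [coeFn_conjL2 α f, coeFn_conjL2 α g] with t hf hg
  simp only [RCLike.inner_apply, hf, hg, map_mul, Complex.conj_conj]
  ring

theorem inner_compression (A : hardySpace →L[ℂ] hardySpace) {α : Linf} (f g : modelSpace α) :
    ⟪f, compression A α g⟫_ℂ = ⟪modelInclusion α f, A (modelInclusion α g)⟫_ℂ :=
  (modelSpace α).inner_orthogonalProjectionOnto_eq_of_mem_left f (A (modelInclusion α g) : L2)

theorem isCSymmetric_compression_iff {A : hardySpace →L[ℂ] hardySpace} {α : Linf}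
    (hα : IsInner α) :
    IsCSymmetric (modelConj hα) (compression A α) ↔ ∀ f g : modelSpace α,
      ⟪modelInclusion α (modelConj hα g), A (modelInclusion α (modelConj hα f))⟫_ℂ =
        ⟪modelInclusion α f, A (modelInclusion α g)⟫_ℂ := by
  simp only [isCSymmetric_iff_inner (C := modelConj hα) fun f g => inner_conjL2_comm α f g,
    inner_compression]

theorem inner_conjL2_mulOp_conjL2 {α : Linf} (hα : ∀ᵐ t ∂circleMeasure, ‖α t‖ = 1) (φ : Linf)
    (f g : L2) : ⟪conjL2 α g, mulOp φ (conjL2 α f)⟫_ℂ = ⟪f, mulOp φ g⟫_ℂ := by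
  rw [L2.inner_def, L2.inner_def]
  refine integral_congr_ae ?_
  filter_upwards [coeFn_conjL2 α f, coeFn_conjL2 α g, coeFn_mulOp φ (conjL2 α f),
    coeFn_mulOp φ g, hα] with t hf hg hφf hφg hαt
  have hα_unit : α t * (starRingEnd ℂ) (α t) = 1 := by simp [RCLike.mul_conj, hαt]
  have hz_unit : fourier 1 t * (starRingEnd ℂ) (fourier 1 t) = 1 := by
    rw [← fourier_neg, ← fourier_add, add_neg_cancel, fourier_zero]
  simp only [RCLike.inner_apply, hφf, hf, hg, hφg, map_mul, Complex.conj_conj]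
  linear_combination (φ t * g t * (starRingEnd ℂ) (f t)) *
    (fourier 1 t * (starRingEnd ℂ) (fourier 1 t) * hα_unit + hz_unit)

theorem isCSymmetric_compression_toeplitz (φ : Linf) {α : Linf} (hα : IsInner α) :
    IsCSymmetric (modelConj hα) (compression (toeplitz φ) α) := by
  refine (isCSymmetric_compression_iff hα).2 fun f g => ?_
  rw [inner_toeplitz, inner_toeplitz]
  exact inner_conjL2_mulOp_conjL2 hα.norm_eq_one φ f g

end CSymmetry

section PowersOfZ

theorem not_isConstant_zPow {n : ℤ} (hn : n ≠ 0) : ¬ IsConstant (zPow n) := by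
  rintro ⟨c, hc⟩
  have hsmul : monomial n = c • monomial 0 := by
    refine Lp.ext ?_
    filter_upwards [hc, coeFn_zPow n, coeFn_fourierLp 2 n, coeFn_fourierLp 2 0,
      Lp.coeFn_smul c (monomial 0)] with t hct hz hn h0 hc0
    rw [hc0, Pi.smul_apply, h0, hn, ← hz, hct, fourier_zero, smul_eq_mul, mul_one]
  have hself : ⟪monomial n, monomial n⟫_ℂ = 0 := by
    nth_rewrite 2 [hsmul]
    rw [inner_smul_right, orthonormal_fourier.2 hn, mul_zero]
  exact orthonormal_fourier.ne_zero n (inner_self_eq_zero.1 hself)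

theorem monomial_mem_modelSpace_zPow {n k : ℤ} (hk : 0 ≤ k) (hkn : k < n) :
    monomial k ∈ modelSpace (zPow n) := by
  refine Submodule.mem_inf.2 ⟨fourierLp_mem_hardySpace hk, (Submodule.mem_orthogonal' _ _).2 ?_⟩
  rintro _ ⟨f, hf, rfl⟩
  calc ⟪monomial k, mulOp (zPow n) f⟫_ℂ
      = ⟪mulOp (zPow n) (monomial (k - n)), mulOp (zPow n) f⟫_ℂ := by
        rw [mulOp_zPow_monomial, add_sub_cancel]
    _ = ⟪monomial (k - n), f⟫_ℂ := inner_mulOp_mulOp (ae_norm_zPow n) _ _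
    _ = 0 := mem_hardySpace_iff.1 hf _ (sub_neg.2 hkn)

theorem conjL2_zPow_monomial (n k : ℤ) : conjL2 (zPow n) (monomial k) = monomial (n - 1 - k) := by
  refine Lp.ext ?_
  filter_upwards [coeFn_conjL2 (zPow n) (monomial k), coeFn_zPow n, coeFn_fourierLp 2 k,
    coeFn_fourierLp 2 (n - 1 - k)] with t h hz hk hnk
  rw [h, hz, hk, hnk, ← fourier_add, ← fourier_neg, ← fourier_add, ← sub_eq_add_neg,
    sub_add_eq_sub_sub]

/-- The function `zᵏ`, `k < n`, as an element of `K²_{zⁿ}`. -/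
def modelMonomial {n k : ℕ} (hk : k < n) : modelSpace (zPow n) :=
  ⟨monomial k, monomial_mem_modelSpace_zPow k.cast_nonneg (Nat.cast_lt.2 hk)⟩

theorem modelInclusion_modelMonomial {n k : ℕ} (hk : k < n) :
    modelInclusion (zPow n) (modelMonomial hk) = hardyBasis k :=
  Subtype.ext (coe_hardyBasis k).symm

theorem modelConj_modelMonomial {n k l : ℕ} (h : k + l + 1 = n) :
    modelConj (isInner_zPow n) (modelMonomial (show k < n by omega)) =
      modelMonomial (show l < n by omega) :=
  Subtype.ext <| (conjL2_zPow_monomial n k).trans <| congrArg monomial (by omega)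

theorem hasToeplitzMatrix_of_isCSymmetric {A : hardySpace →L[ℂ] hardySpace}
    (hA : ∀ n : ℕ, 1 ≤ n → IsCSymmetric (modelConj (isInner_zPow n)) (compression A (zPow n))) :
    HasToeplitzMatrix A := by
  intro i j
  let n := i + j + 2
  have hi : i < n := by omega
  have hj : j < n := by omega
  have hsymm := (isCSymmetric_compression_iff (isInner_zPow n)).1 (hA n (by omega))
    (modelMonomial hi) (modelMonomial hj)
  rwa [modelConj_modelMonomial (show j + (i + 1) + 1 = n by omega),
    modelConj_modelMonomial (show i + (j + 1) + 1 = n by omega), modelInclusion_modelMonomial,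
    modelInclusion_modelMonomial, modelInclusion_modelMonomial,
    modelInclusion_modelMonomial] at hsymm

end PowersOfZ

end ModelSpace

end

theorem theorem2p2 (A : ModelSpace.hardySpace →L[ℂ] ModelSpace.hardySpace) :
    List.TFAE [
      ∃ φ : ModelSpace.Linf, A = ModelSpace.toeplitz φ,
      ∀ (α : ModelSpace.Linf) (hα : ModelSpace.IsInner α), ¬ ModelSpace.IsConstant α →
        ModelSpace.IsCSymmetric (ModelSpace.modelConj hα) (ModelSpace.compression A α),
      ∀ n : ℕ, 1 ≤ n →
        ModelSpace.IsCSymmetric (ModelSpace.modelConj (ModelSpace.isInner_zPow n))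
          (ModelSpace.compression A (ModelSpace.zPow n))] := by
  tfae_have 1 → 2 := by
    rintro ⟨φ, rfl⟩ α hα _
    exact ModelSpace.isCSymmetric_compression_toeplitz φ hα
  tfae_have 2 → 3 := fun h n hn =>
    h _ (ModelSpace.isInner_zPow n)
      (ModelSpace.not_isConstant_zPow (Nat.cast_ne_zero.2 (Nat.one_le_iff_ne_zero.1 hn)))
  tfae_have 3 → 1 := fun h =>
    (ModelSpace.hasToeplitzMatrix_of_isCSymmetric h).exists_eq_toeplitz
  tfae_finish
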